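/- Let $(Z_i)_{i\ge 1}$ be independent random variables on a probability space with values in $\{-1,+1\}$, and let $r_i=\mathbb P(Z_i=+1)$. Put $T_N=\sum_{i=1}^N Z_i$ and $$a_N:=\mathbb E(T_N)=\sum_{i=1}^N(2r_i-1),\qquad b_N^2:=\operatorname{Var}(T_N)=4\sum_{i=1}^N r_i(1-r_i),\qquad b_N\ge 0.$$ Suppose that $$\lim_{N\to\infty}\frac{a_N}{\sqrt N}=0,\qquad \liminf_{N\to\infty}\frac{b_N^2}{N}>0.$$ For every $N$ with $b_N>0$ (hence for all large $N$) let $T_{N,\sigma}$ be a random variable with values in $L_N=2\mathbb Z+(N \bmod 2)$ and law $$\mathbb P(T_{N,\sigma}=k)=\Phi\left(\frac{k+1}{b_N}\right)-\Phi\left(\frac{k-1}{b_N}\right),\qquad k\in L_N,$$ where $\Phi$ is the standard Gaussian distribution function; this is indeed a probability law, and it is symmetric about $0$. Then $$\lim_{N\to\infty}\|\mathcal L(T_N)-\mathcal L(T_{N,\sigma})\|_{TV}=0,$$ where $\|\mu-\nu\|_{TV}=\sup_{A}\,(\mu(A)-\nu(A))$, the supremum being over all measurable sets $A$. -/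

import Mathlib

open MeasureTheory ProbabilityTheory Filter Topology

noncomputable section

namespace SignCLT

/-- Total variation distance `sup_A (μ A - ν A)`, the supremum being over all measurable sets. -/
def tvDist {Ω : Type*} [MeasurableSpace Ω] (μ ν : Measure Ω) : ℝ :=
  ⨆ A : {A : Set Ω // MeasurableSet A}, (μ.real A.1 - ν.real A.1)

/-- The standard Gaussian distribution function. -/
def Phi (x : ℝ) : ℝ := cdf (gaussianReal 0 1) x

/-- The lattice `2ℤ + (N mod 2)`. -/
def lattice (N : ℕ) : Set ℤ := {k | ∃ m : ℤ, k = 2 * m + ((N % 2 : ℕ) : ℤ)}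

/-- The measure on `ℤ`, carried by `lattice N`, giving mass `Φ((k+1)/b) - Φ((k-1)/b)` to each
`k ∈ lattice N`. -/
def discreteGaussian (N : ℕ) (b : ℝ) : Measure ℤ :=
  Measure.sum fun k : ℤ =>
    ENNReal.ofReal
      ((lattice N).indicator (fun j : ℤ => Phi (((j : ℝ) + 1) / b) - Phi (((j : ℝ) - 1) / b)) k) •
    Measure.dirac k

/-- The sum of the first `N` terms of the sequence `Z` (indexed from `0`). -/
def partialSum {Ω : Type*} (Z : ℕ → Ω → ℤ) (N : ℕ) (ω : Ω) : ℤ :=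
  ∑ i ∈ Finset.range N, Z i ω

end SignCLT

end

/-!
A local limit theorem, proved by Fourier inversion, summed over a window of width of order `b N`.

Write `m i = 2 r i - 1`. The characteristic function of `T_N` is the product `sumChar` of the factors
`cos t + i m sin t`. Each factor has modulus at most `exp (-(1 - m²) sin² t / 2)`, so that on
`[-π/2, π/2]` the rescaled product `sumChar m N (s / b N)` is dominated by a fixed Gaussian
(`norm_sumChar_div_le`). Each factor also agrees with `exp (i m t - (1 - m²) t² / 2)` up to
`O(|t|³)` uniformly in `m` (`norm_signChar_sub_exp_le`), so that the product converges pointwise to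
`exp (-s² / 2)`, because `a N / b N → 0` and `N / b N ^ 3 → 0`. By dominated convergence the
`L¹` distance `charDefect` tends to `0`.

Since `T_N` lives on `lattice N`, where distinct points differ by at least `2`, Fourier inversion
over `[-π/2, π/2]` recovers its point masses, and `b N * P(T_N = k)` is within `charDefect / π` of
twice the Gaussian density at `k / b N`, uniformly in `k`
(`abs_mul_measureReal_partialSum_sub_le`). The same holds for the discrete Gaussian with error
`2 / b N`, as the Gaussian density is `1`-Lipschitz (`abs_mul_Phi_sub_Phi_sub_le`). The point masses
of the two laws therefore differ by `o(1 / b N)`. Summation over `|k| ≤ M b N` costs `o(1)`, and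
as `tvDist` is one-sided only the tail of `T_N` outside this window remains, which
Chebyshev's inequality bounds by `1 / (M - 1)²` (`tvDist_le_of_singleton_le`,
`measureReal_partialSum_tail_le`).
-/

namespace SignCLT

/-! ### Characteristic functions of sums of signs -/

/-- The characteristic function `t ↦ E exp(itZ)` of a random sign `Z ∈ {-1, 1}` with mean `m`. -/
noncomputable def signChar (m t : ℝ) : ℂ :=
  (Real.cos t : ℂ) + ((m * Real.sin t : ℝ) : ℂ) * Complex.I

lemma continuous_signChar (m : ℝ) : Continuous (signChar m) := by
  unfold signChar
  fun_prop

lemma norm_signChar_le {m : ℝ} (t : ℝ) :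
    ‖signChar m t‖ ≤ Real.exp (-((1 - m ^ 2) * Real.sin t ^ 2 / 2)) := by
  rw [signChar, Complex.norm_add_mul_I]
  refine Real.sqrt_le_iff.2 ⟨(Real.exp_pos _).le, ?_⟩
  -- the squared modulus is `1 - (1 - m²) sin² t`
  rw [← Real.exp_nat_mul]
  refine le_trans (le_of_eq ?_) (Real.add_one_le_exp _)
  push_cast
  nlinarith [Real.sin_sq_add_cos_sq t]

/-- The Gaussian with the same mean and variance as a random sign of mean `m` has the same second
order expansion of its characteristic function, uniformly in `m`. -/
lemma norm_signChar_sub_exp_le {m t : ℝ} (hm : |m| ≤ 1) (ht : |t| ≤ 1 / 2) :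
    ‖signChar m t - Complex.exp ((m * t : ℝ) * Complex.I - ((1 - m ^ 2) * t ^ 2 / 2 : ℝ))‖ ≤
      20 * |t| ^ 3 := by
  obtain ⟨v, hv⟩ : ∃ v, v = 1 - m ^ 2 := ⟨_, rfl⟩
  have hm2 : m ^ 2 ≤ 1 := (sq_le_one_iff_abs_le_one m).2 hm
  have hv0 : 0 ≤ v := by linarith
  have hv1 : v ≤ 1 := by nlinarith [sq_nonneg m]
  rw [← hv]
  set u := |t| with hu
  have hu0 : 0 ≤ u := abs_nonneg t
  have htu : t ^ 2 = u ^ 2 := (sq_abs t).symm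
  set z : ℂ := (m * t : ℝ) * Complex.I - (v * t ^ 2 / 2 : ℝ) with hz
  have hz1 : ‖z‖ ≤ 5 / 4 * u := by
    refine (norm_sub_le _ _).trans ?_
    rw [norm_mul, Complex.norm_I, mul_one, Complex.norm_real, Complex.norm_real, Real.norm_eq_abs,
      Real.norm_eq_abs, abs_mul, abs_of_nonneg (by positivity : 0 ≤ v * t ^ 2 / 2), htu, ← hu]
    have h1 : |m| * u ≤ 1 * u := by gcongr
    have h2 : v * u ^ 2 ≤ 1 * u ^ 2 := by gcongr
    nlinarith
  have hE : ‖Complex.exp z - (1 + z + z ^ 2 / 2)‖ ≤ 2 * u ^ 3 := by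
    have h := Complex.exp_bound (x := z) (by linarith) (n := 3) (by norm_num)
    have h' : ∑ k ∈ Finset.range 3, z ^ k / (k.factorial : ℂ) = 1 + z + z ^ 2 / 2 := by
      simp [Finset.sum_range_succ, Nat.factorial]
    rw [h'] at h
    refine h.trans ?_
    have h3 : ‖z‖ ^ 3 ≤ (5 / 4 * u) ^ 3 := by gcongr
    norm_num [Nat.factorial] at *
    nlinarith [pow_nonneg hu0 3]
  have hcos : |Real.cos t - (1 - t ^ 2 / 2)| ≤ u ^ 3 := by
    refine (Real.cos_bound (by linarith)).trans ?_
    nlinarith [pow_nonneg hu0 3, pow_nonneg hu0 4]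
  have hsin : |Real.sin t - t| ≤ u ^ 3 := by
    have h1 := Real.sin_bound (x := t) (by linarith)
    have h2 : |t ^ 3 / 6| = u ^ 3 / 6 := by rw [abs_div, abs_pow]; norm_num [hu]
    have h3 : Real.sin t - t = (Real.sin t - (t - t ^ 3 / 6)) - t ^ 3 / 6 := by ring
    rw [h3]
    refine (abs_sub _ _).trans ?_
    rw [h2]
    have h5 : u ^ 5 ≤ u ^ 3 := by
      refine pow_le_pow_of_le_one hu0 (by linarith) (by norm_num)
    have := pow_nonneg hu0 3
    rw [← hu] at h1
    linarith
  -- the terms up to second order of both functions agree, as `(1 - m²) + m² = 1`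
  have key : signChar m t - Complex.exp z =
      ((Real.cos t - (1 - t ^ 2 / 2) : ℝ) : ℂ) + ((m * (Real.sin t - t) : ℝ) : ℂ) * Complex.I
        - (Complex.exp z - (1 + z + z ^ 2 / 2))
        + ((m * v * t ^ 3 / 2 : ℝ) : ℂ) * Complex.I - ((v ^ 2 * t ^ 4 / 8 : ℝ) : ℂ) := by
    have hvC : (v : ℂ) = 1 - (m : ℂ) ^ 2 := by rw [hv]; push_cast; ring
    simp only [signChar, hz]
    push_cast
    rw [hvC]
    linear_combination (-(1/2) * (m : ℂ) ^ 2 * t ^ 2) * Complex.I_sq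
  rw [key]
  have hA : ‖((m * (Real.sin t - t) : ℝ) : ℂ) * Complex.I‖ ≤ u ^ 3 := by
    rw [norm_mul, Complex.norm_I, mul_one, Complex.norm_real, Real.norm_eq_abs, abs_mul]
    calc |m| * |Real.sin t - t| ≤ 1 * u ^ 3 := by gcongr
      _ = u ^ 3 := one_mul _
  have hB : ‖((m * v * t ^ 3 / 2 : ℝ) : ℂ) * Complex.I‖ ≤ u ^ 3 := by
    rw [norm_mul, Complex.norm_I, mul_one, Complex.norm_real, Real.norm_eq_abs, abs_div, abs_mul,
      abs_mul, abs_of_nonneg hv0, abs_pow, ← hu, abs_two]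
    have : |m| * v * u ^ 3 ≤ 1 * 1 * u ^ 3 := by gcongr
    have := pow_nonneg hu0 3
    linarith
  have hC : ‖((v ^ 2 * t ^ 4 / 8 : ℝ) : ℂ)‖ ≤ u ^ 3 := by
    rw [Complex.norm_real, Real.norm_eq_abs, abs_of_nonneg (by positivity)]
    have h4 : t ^ 4 = u ^ 4 := by rw [show t ^ 4 = (t ^ 2) ^ 2 by ring, htu]; ring
    have h5 : u ^ 4 ≤ u ^ 3 := by
      refine pow_le_pow_of_le_one hu0 (by linarith) (by norm_num)
    have : v ^ 2 * u ^ 4 ≤ 1 ^ 2 * u ^ 3 := by gcongr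
    have := pow_nonneg hu0 3
    rw [h4]
    linarith
  have hD : ‖((Real.cos t - (1 - t ^ 2 / 2) : ℝ) : ℂ)‖ ≤ u ^ 3 := by
    rw [Complex.norm_real]; exact hcos
  have := pow_nonneg hu0 3
  refine (norm_sub_le _ _).trans ?_
  refine (add_le_add ((norm_add_le _ _).trans (add_le_add ((norm_sub_le _ _).trans
    (add_le_add (norm_add_le _ _) le_rfl)) le_rfl)) le_rfl).trans ?_
  linarith

lemma norm_prod_sub_prod_le_sum (f g : ℕ → ℂ) (hf : ∀ i, ‖f i‖ ≤ 1) (hg : ∀ i, ‖g i‖ ≤ 1) (N : ℕ) :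
    ‖∏ i ∈ Finset.range N, f i - ∏ i ∈ Finset.range N, g i‖ ≤
      ∑ i ∈ Finset.range N, ‖f i - g i‖ := by
  induction N with
  | zero => simp
  | succ n ih =>
    rw [Finset.prod_range_succ, Finset.prod_range_succ, Finset.sum_range_succ]
    have hp : ‖∏ i ∈ Finset.range n, f i‖ ≤ 1 := by
      rw [norm_prod]; exact Finset.prod_le_one (fun _ _ => norm_nonneg _) fun i _ => hf i
    have h : (∏ i ∈ Finset.range n, f i) * f n - (∏ i ∈ Finset.range n, g i) * g n =
        (∏ i ∈ Finset.range n, f i - ∏ i ∈ Finset.range n, g i) * g n +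
          (∏ i ∈ Finset.range n, f i) * (f n - g n) := by ring
    rw [h]
    refine (norm_add_le _ _).trans ?_
    rw [norm_mul, norm_mul]
    have h1 := mul_le_mul_of_nonneg_left (hg n)
      (norm_nonneg (∏ i ∈ Finset.range n, f i - ∏ i ∈ Finset.range n, g i))
    have h2 := mul_le_mul_of_nonneg_right hp (norm_nonneg (f n - g n))
    linarith

/-- The characteristic function of a sum of `N` independent random signs with means `m 0, m 1, …`. -/
noncomputable def sumChar (m : ℕ → ℝ) (N : ℕ) (t : ℝ) : ℂ := ∏ i ∈ Finset.range N, signChar (m i) t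

lemma continuous_sumChar (m : ℕ → ℝ) (N : ℕ) : Continuous (sumChar m N) := by
  unfold sumChar
  exact continuous_finsetProd _ fun i _ => continuous_signChar (m i)

lemma norm_sumChar_le (m : ℕ → ℝ) (N : ℕ) (t : ℝ) :
    ‖sumChar m N t‖ ≤
      Real.exp (-((∑ i ∈ Finset.range N, (1 - m i ^ 2)) * Real.sin t ^ 2 / 2)) := by
  rw [sumChar, norm_prod, Finset.sum_mul, Finset.sum_div, ← Finset.sum_neg_distrib, Real.exp_sum]
  exact Finset.prod_le_prod (fun _ _ => norm_nonneg _) fun i _ => norm_signChar_le t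

/-- On the fundamental domain `[-π/2, π/2]` the characteristic function is dominated by a Gaussian. -/
lemma norm_sumChar_div_le (m : ℕ → ℝ) {N : ℕ} {b s : ℝ} (hb : 0 < b)
    (hbm : b ^ 2 = ∑ i ∈ Finset.range N, (1 - m i ^ 2)) (hs : |s| ≤ Real.pi * b / 2) :
    ‖sumChar m N (s / b)‖ ≤ Real.exp (-(2 / Real.pi ^ 2) * s ^ 2) := by
  refine (norm_sumChar_le m N _).trans (Real.exp_le_exp.2 ?_)
  rw [← hbm]
  have h1 : |s / b| ≤ Real.pi / 2 := by
    rw [abs_div, abs_of_pos hb, div_le_iff₀ hb]; linarith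
  have h2 := Real.mul_abs_le_abs_sin h1
  have h3 : (2 / Real.pi * |s / b|) ^ 2 ≤ Real.sin (s / b) ^ 2 := by
    rw [← sq_abs (Real.sin _)]
    have := Real.pi_pos
    gcongr
  have h4 : b ^ 2 * (2 / Real.pi * |s / b|) ^ 2 = 2 * (2 / Real.pi ^ 2) * s ^ 2 := by
    rw [mul_pow, sq_abs]
    field_simp
  have h5 := mul_le_mul_of_nonneg_left h3 (sq_nonneg b)
  linarith

lemma norm_sumChar_sub_exp_le {m : ℕ → ℝ} (hm : ∀ i, |m i| ≤ 1) (N : ℕ) {t : ℝ}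
    (ht : |t| ≤ 1 / 2) :
    ‖sumChar m N t - Complex.exp (((∑ i ∈ Finset.range N, m i) * t : ℝ) * Complex.I
      - ((∑ i ∈ Finset.range N, (1 - m i ^ 2)) * t ^ 2 / 2 : ℝ))‖ ≤ N * (20 * |t| ^ 3) := by
  have hm2 : ∀ i, 0 ≤ 1 - m i ^ 2 := fun i => by
    have := (sq_le_one_iff_abs_le_one (m i)).2 (hm i)
    linarith
  have hexp : Complex.exp (((∑ i ∈ Finset.range N, m i) * t : ℝ) * Complex.I
      - ((∑ i ∈ Finset.range N, (1 - m i ^ 2)) * t ^ 2 / 2 : ℝ)) =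
      ∏ i ∈ Finset.range N, Complex.exp ((m i * t : ℝ) * Complex.I
        - ((1 - m i ^ 2) * t ^ 2 / 2 : ℝ)) := by
    rw [← Complex.exp_sum]
    congr 1
    push_cast
    simp only [Finset.sum_mul, Finset.sum_div, ← Finset.sum_sub_distrib]
  rw [hexp, sumChar]
  refine (norm_prod_sub_prod_le_sum _ _ (fun i => ?_) (fun i => ?_) N).trans ?_
  · refine (norm_signChar_le t).trans (Real.exp_le_one_iff.2 ?_)
    have := mul_nonneg (hm2 i) (sq_nonneg (Real.sin t))
    linarith
  · rw [Complex.norm_exp]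
    refine Real.exp_le_one_iff.2 ?_
    have := mul_nonneg (hm2 i) (sq_nonneg t)
    simp only [Complex.sub_re, Complex.mul_re, Complex.ofReal_re, Complex.ofReal_im, Complex.I_re,
      Complex.I_im]
    linarith
  · refine (Finset.sum_le_sum fun i _ => norm_signChar_sub_exp_le (hm i) ht).trans ?_
    simp

/-- The `L¹` distance between the characteristic function of `T_N / b`, cut off to the interval
`|s| ≤ πb/2` on which lattice Fourier inversion takes place, and that of the standard Gaussian. -/
noncomputable def charDefect (m : ℕ → ℝ) (N : ℕ) (b : ℝ) : ℝ :=
  ∫ s : ℝ, ‖(Set.Ioc (-(Real.pi * b / 2)) (Real.pi * b / 2)).indicator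
    (fun s => sumChar m N (s / b)) s - Complex.exp (-(s : ℂ) ^ 2 / 2)‖

lemma norm_cexp_neg_sq_div_two (s : ℝ) :
    ‖Complex.exp (-(s : ℂ) ^ 2 / 2)‖ = Real.exp (-(1 / 2) * s ^ 2) := by
  rw [Complex.norm_exp]
  congr 1
  have : (-(s : ℂ) ^ 2 / 2) = ((-(1 / 2) * s ^ 2 : ℝ) : ℂ) := by push_cast; ring
  rw [this, Complex.ofReal_re]

/-- Pointwise convergence of characteristic functions; this is where `a_N = o(√N)` is used. -/
lemma tendsto_sumChar {m : ℕ → ℝ} (hm : ∀ i, |m i| ≤ 1) {b : ℕ → ℝ}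
    (hbm : ∀ N, b N ^ 2 = ∑ i ∈ Finset.range N, (1 - m i ^ 2))
    (hbtop : Tendsto b atTop atTop)
    (hmean : Tendsto (fun N => (∑ i ∈ Finset.range N, m i) / b N) atTop (𝓝 0))
    (hcub : Tendsto (fun N : ℕ => (N : ℝ) / b N ^ 3) atTop (𝓝 0)) (s : ℝ) :
    Tendsto (fun N => sumChar m N (s / b N)) atTop (𝓝 (Complex.exp (-(s : ℂ) ^ 2 / 2))) := by
  have h1 : Tendsto (fun N => Complex.exp
      ((((∑ i ∈ Finset.range N, m i) / b N * s : ℝ) : ℂ) * Complex.I - (s ^ 2 / 2 : ℝ))) atTop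
      (𝓝 (Complex.exp (-(s : ℂ) ^ 2 / 2))) := by
    have hc : Continuous fun x : ℝ => Complex.exp
      (((x * s : ℝ) : ℂ) * Complex.I - (s ^ 2 / 2 : ℝ)) := by fun_prop
    have := (hc.tendsto 0).comp hmean
    convert! this using 2
    push_cast
    ring_nf
  have h2 : Tendsto (fun N => sumChar m N (s / b N) - Complex.exp
      ((((∑ i ∈ Finset.range N, m i) / b N * s : ℝ) : ℂ) * Complex.I - (s ^ 2 / 2 : ℝ))) atTop
      (𝓝 0) := by
    have hlim : Tendsto (fun N : ℕ => 20 * |s| ^ 3 * ((N : ℝ) / b N ^ 3)) atTop (𝓝 0) := by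
      simpa using hcub.const_mul (20 * |s| ^ 3)
    refine squeeze_zero_norm' ?_ hlim
    filter_upwards [hbtop.eventually_ge_atTop (2 * |s| + 1)] with N hN
    have hb : 0 < b N := by have := abs_nonneg s; linarith
    have ht : |s / b N| ≤ 1 / 2 := by
      rw [abs_div, abs_of_pos hb, div_le_iff₀ hb]; linarith
    have h := norm_sumChar_sub_exp_le hm N ht
    rw [← hbm] at h
    have e1 : b N ^ 2 * (s / b N) ^ 2 / 2 = s ^ 2 / 2 := by field_simp
    have e2 : (∑ i ∈ Finset.range N, m i) * (s / b N) = (∑ i ∈ Finset.range N, m i) / b N * s := by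
      ring
    rw [e1, e2] at h
    refine h.trans (le_of_eq ?_)
    rw [abs_div, abs_of_pos hb]
    field_simp
  simpa using h2.add h1

lemma tendsto_charDefect {m : ℕ → ℝ} (hm : ∀ i, |m i| ≤ 1) {b : ℕ → ℝ}
    (hbm : ∀ N, b N ^ 2 = ∑ i ∈ Finset.range N, (1 - m i ^ 2))
    (hbtop : Tendsto b atTop atTop)
    (hmean : Tendsto (fun N => (∑ i ∈ Finset.range N, m i) / b N) atTop (𝓝 0))
    (hcub : Tendsto (fun N : ℕ => (N : ℝ) / b N ^ 3) atTop (𝓝 0)) :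
    Tendsto (fun N => charDefect m N (b N)) atTop (𝓝 0) := by
  have hpi := Real.pi_pos
  have h0 : (0 : ℝ) = ∫ _ : ℝ, (0 : ℝ) := by simp
  rw [h0]
  unfold charDefect
  refine tendsto_integral_filter_of_dominated_convergence
    (fun s => Real.exp (-(2 / Real.pi ^ 2) * s ^ 2) + Real.exp (-(1 / 2) * s ^ 2)) ?_ ?_ ?_ ?_
  · refine Eventually.of_forall fun N => ?_
    refine AEStronglyMeasurable.norm (AEStronglyMeasurable.sub ?_ ?_)
    · exact (((continuous_sumChar m N).comp (continuous_id.div_const _)).aestronglyMeasurable).indicator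
        measurableSet_Ioc
    · exact Continuous.aestronglyMeasurable (by fun_prop)
  · filter_upwards [hbtop.eventually_gt_atTop 0] with N hN
    refine Eventually.of_forall fun s => ?_
    rw [norm_norm]
    refine (norm_sub_le _ _).trans (add_le_add ?_ (norm_cexp_neg_sq_div_two s).le)
    by_cases hs : s ∈ Set.Ioc (-(Real.pi * b N / 2)) (Real.pi * b N / 2)
    · rw [Set.indicator_of_mem hs]
      exact norm_sumChar_div_le m hN (hbm N) (abs_le.2 ⟨hs.1.le, hs.2⟩)
    · rw [Set.indicator_of_notMem hs, norm_zero]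
      positivity
  · exact (integrable_exp_neg_mul_sq (by positivity)).add
      (integrable_exp_neg_mul_sq (by positivity))
  · refine Eventually.of_forall fun s => ?_
    have h1 := tendsto_sumChar hm hbm hbtop hmean hcub s
    have h2 := (h1.sub_const (Complex.exp (-(s : ℂ) ^ 2 / 2))).norm
    rw [sub_self, norm_zero] at h2
    refine h2.congr' ?_
    filter_upwards [hbtop.eventually_ge_atTop (|s| + 1)] with N hN
    have hs : s ∈ Set.Ioc (-(Real.pi * b N / 2)) (Real.pi * b N / 2) := by
      have h3 : |s| < Real.pi * b N / 2 := by
        have := abs_nonneg s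
        nlinarith [Real.pi_gt_three]
      exact ⟨(abs_lt.1 h3).1, (abs_lt.1 h3).2.le⟩
    rw [Set.indicator_of_mem hs]

/-! ### Moments, Fourier inversion and the local limit theorem -/

section SingleSign

variable {Ω : Type*} [MeasurableSpace Ω] {μ : Measure Ω} [IsProbabilityMeasure μ]
  {X : Ω → ℤ}

lemma integral_comp_sign (hX : Measurable X) (hsign : ∀ᵐ ω ∂μ, X ω = 1 ∨ X ω = -1)
    {E : Type*} [NormedAddCommGroup E] [NormedSpace ℝ E] [CompleteSpace E] (f : ℤ → E) :
    ∫ ω, f (X ω) ∂μ = μ.real {ω | X ω = 1} • f 1 + (1 - μ.real {ω | X ω = 1}) • f (-1) := by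
  have hm : MeasurableSet {ω | X ω = 1} := hX (measurableSet_singleton 1)
  have h : (fun ω => f (X ω)) =ᵐ[μ] fun ω => ({ω | X ω = 1}.indicator (fun _ => f 1) ω +
      {ω | X ω = 1}ᶜ.indicator (fun _ => f (-1)) ω) := by
    filter_upwards [hsign] with ω hω
    rcases hω with h | h <;> simp [h]
  rw [integral_congr_ae h, integral_add ((integrable_const _).indicator hm)
    ((integrable_const _).indicator hm.compl), integral_indicator_const _ hm,
    integral_indicator_const _ hm.compl, probReal_compl_eq_one_sub hm]

lemma memLp_two_sign (hX : Measurable X) (hsign : ∀ᵐ ω ∂μ, X ω = 1 ∨ X ω = -1) :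
    MemLp (fun ω => (X ω : ℝ)) 2 μ := by
  refine MemLp.of_bound (Measurable.aestronglyMeasurable (by fun_prop)) 1 ?_
  filter_upwards [hsign] with ω hω
  rcases hω with h | h <;> simp [h]

lemma integral_sign (hX : Measurable X) (hsign : ∀ᵐ ω ∂μ, X ω = 1 ∨ X ω = -1) :
    ∫ ω, (X ω : ℝ) ∂μ = 2 * μ.real {ω | X ω = 1} - 1 := by
  rw [integral_comp_sign hX hsign (fun k => (k : ℝ))]
  simp only [smul_eq_mul]
  push_cast
  ring

lemma variance_sign (hX : Measurable X) (hsign : ∀ᵐ ω ∂μ, X ω = 1 ∨ X ω = -1) :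
    variance (fun ω => (X ω : ℝ)) μ = 1 - (2 * μ.real {ω | X ω = 1} - 1) ^ 2 := by
  rw [variance_eq_sub (memLp_two_sign hX hsign), integral_sign hX hsign]
  have := integral_comp_sign hX hsign (fun k => (k : ℝ) ^ 2)
  simp only [Pi.pow_apply]
  rw [this]
  simp only [smul_eq_mul]
  push_cast
  ring

lemma integral_cexp_sign (hX : Measurable X) (hsign : ∀ᵐ ω ∂μ, X ω = 1 ∨ X ω = -1) (t : ℝ) :
    ∫ ω, Complex.exp ((t * X ω : ℝ) * Complex.I) ∂μ =
      signChar (2 * μ.real {ω | X ω = 1} - 1) t := by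
  rw [integral_comp_sign hX hsign (fun k => Complex.exp ((t * k : ℝ) * Complex.I)), signChar]
  simp only [Int.cast_one, Int.cast_neg, mul_one, mul_neg, Complex.ofReal_neg, Complex.real_smul]
  rw [Complex.exp_mul_I, Complex.exp_mul_I, Complex.cos_neg, Complex.sin_neg]
  push_cast
  ring

end SingleSign

section Sum

variable {Ω : Type*} [MeasurableSpace Ω] {μ : Measure Ω} [IsProbabilityMeasure μ]
  {Z : ℕ → Ω → ℤ}

lemma measurable_partialSum (hZ : ∀ i, Measurable (Z i)) (N : ℕ) :
    Measurable (partialSum Z N) := by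
  unfold partialSum
  exact Finset.measurable_sum _ fun i _ => hZ i

lemma partialSum_cast {Ω : Type*} (Z : ℕ → Ω → ℤ) (N : ℕ) :
    (fun ω => (partialSum Z N ω : ℝ)) = ∑ i ∈ Finset.range N, fun ω => (Z i ω : ℝ) := by
  ext ω
  simp [partialSum]

lemma memLp_two_partialSum (hZ : ∀ i, Measurable (Z i))
    (hsign : ∀ i, ∀ᵐ ω ∂μ, Z i ω = 1 ∨ Z i ω = -1) (N : ℕ) :
    MemLp (fun ω => (partialSum Z N ω : ℝ)) 2 μ := by
  rw [partialSum_cast]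
  exact memLp_finsetSum' _ fun i _ => memLp_two_sign (hZ i) (hsign i)

lemma integral_partialSum (hZ : ∀ i, Measurable (Z i))
    (hsign : ∀ i, ∀ᵐ ω ∂μ, Z i ω = 1 ∨ Z i ω = -1) (N : ℕ) :
    ∫ ω, (partialSum Z N ω : ℝ) ∂μ =
      ∑ i ∈ Finset.range N, (2 * μ.real {ω | Z i ω = 1} - 1) := by
  simp only [partialSum, Int.cast_sum]
  rw [integral_finsetSum _ fun i _ => (memLp_two_sign (hZ i) (hsign i)).integrable (by norm_num)]
  exact Finset.sum_congr rfl fun i _ => integral_sign (hZ i) (hsign i)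

lemma variance_partialSum (hZ : ∀ i, Measurable (Z i)) (hind : iIndepFun Z μ)
    (hsign : ∀ i, ∀ᵐ ω ∂μ, Z i ω = 1 ∨ Z i ω = -1) (N : ℕ) :
    variance (fun ω => (partialSum Z N ω : ℝ)) μ =
      ∑ i ∈ Finset.range N, (1 - (2 * μ.real {ω | Z i ω = 1} - 1) ^ 2) := by
  rw [partialSum_cast, IndepFun.variance_sum (fun i _ => memLp_two_sign (hZ i) (hsign i))]
  · exact Finset.sum_congr rfl fun i _ => variance_sign (hZ i) (hsign i)
  · intro i _ j _ hij
    exact (hind.indepFun hij).comp (φ := fun k : ℤ => (k : ℝ)) (ψ := fun k : ℤ => (k : ℝ))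
      (by fun_prop) (by fun_prop)

lemma integral_cexp_partialSum (hZ : ∀ i, Measurable (Z i)) (hind : iIndepFun Z μ)
    (hsign : ∀ i, ∀ᵐ ω ∂μ, Z i ω = 1 ∨ Z i ω = -1) (N : ℕ) (t : ℝ) :
    ∫ ω, Complex.exp ((t * partialSum Z N ω : ℝ) * Complex.I) ∂μ =
      sumChar (fun i => 2 * μ.real {ω | Z i ω = 1} - 1) N t := by
  have h1 : ∀ ω, Complex.exp ((t * partialSum Z N ω : ℝ) * Complex.I) =
      ∏ i : Fin N, Complex.exp ((t * Z i ω : ℝ) * Complex.I) := by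
    intro ω
    rw [← Finset.prod_range (fun i => Complex.exp ((t * Z i ω : ℝ) * Complex.I)),
      ← Complex.exp_sum, partialSum]
    congr 1
    push_cast
    rw [Finset.mul_sum, Finset.sum_mul]
  simp only [h1]
  rw [(hind.precomp (Fin.val_injective (n := N))).integral_fun_prod_comp
    (f := fun (_ : Fin N) (k : ℤ) => Complex.exp ((t * k : ℝ) * Complex.I))
    (fun i => (hZ i).aemeasurable) (fun i => Measurable.aestronglyMeasurable (by fun_prop)),
    sumChar, Finset.prod_range]
  exact Finset.prod_congr rfl fun i _ => integral_cexp_sign (hZ i) (hsign i) t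

lemma partialSum_mem_lattice {Ω : Type*} [MeasurableSpace Ω] {μ : Measure Ω} {Z : ℕ → Ω → ℤ}
    (hsign : ∀ i, ∀ᵐ ω ∂μ, Z i ω = 1 ∨ Z i ω = -1) (N : ℕ) :
    ∀ᵐ ω ∂μ, partialSum Z N ω ∈ lattice N := by
  filter_upwards [ae_all_iff.2 hsign] with ω hω
  have h : ∃ m : ℤ, partialSum Z N ω = 2 * m + N := by
    induction N with
    | zero => exact ⟨0, by simp [partialSum]⟩
    | succ n ih =>
      obtain ⟨m, hm⟩ := ih
      have hs : partialSum Z (n + 1) ω = partialSum Z n ω + Z n ω := by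
        simp [partialSum, Finset.sum_range_succ]
      rcases hω n with h | h
      · exact ⟨m, by rw [hs, hm, h]; push_cast; ring⟩
      · exact ⟨m - 1, by rw [hs, hm, h]; push_cast; ring⟩
  obtain ⟨m, hm⟩ := h
  -- `lattice N` is based at `N % 2` rather than at `N`
  refine ⟨m + (N / 2 : ℕ), ?_⟩
  rw [hm]
  push_cast
  omega

/-- The characters `t ↦ exp(i(l-k)t)` with `l, k` of the same parity are orthonormal on
`[-π/2, π/2]`. -/
lemma integral_cexp_lattice {N : ℕ} {k l : ℤ} (hk : k ∈ lattice N) (hl : l ∈ lattice N) :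
    ∫ t in (-(Real.pi / 2))..(Real.pi / 2), Complex.exp ((t * (l - k : ℤ) : ℝ) * Complex.I) =
      if l = k then (Real.pi : ℂ) else 0 := by
  obtain ⟨p, hp⟩ := hk
  obtain ⟨q, hq⟩ := hl
  split_ifs with h
  · simp [h]
  · have hne : ((l - k : ℤ) : ℂ) * Complex.I ≠ 0 :=
      mul_ne_zero (by exact_mod_cast sub_ne_zero.2 h) Complex.I_ne_zero
    have e : ∀ t : ℝ, Complex.exp ((t * (l - k : ℤ) : ℝ) * Complex.I) =
        Complex.exp (((l - k : ℤ) : ℂ) * Complex.I * t) := fun t => by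
      congr 1; push_cast; ring
    simp only [e]
    rw [integral_exp_mul_complex hne]
    have hlk : l - k = 2 * (q - p) := by omega
    have : Complex.exp (((l - k : ℤ) : ℂ) * Complex.I * (Real.pi / 2 : ℝ)) =
        Complex.exp (((l - k : ℤ) : ℂ) * Complex.I * (-(Real.pi / 2) : ℝ)) := by
      rw [Complex.exp_eq_exp_iff_exists_int]
      refine ⟨q - p, ?_⟩
      rw [hlk]
      push_cast
      ring
    rw [this, sub_self, zero_div]

/-- Fourier inversion for a random variable carried by `lattice N`. -/
lemma pi_mul_measureReal_partialSum_eq (hZ : ∀ i, Measurable (Z i)) (hind : iIndepFun Z μ)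
    (hsign : ∀ i, ∀ᵐ ω ∂μ, Z i ω = 1 ∨ Z i ω = -1) {N : ℕ} {k : ℤ} (hk : k ∈ lattice N) :
    ((Real.pi * μ.real {ω | partialSum Z N ω = k} : ℝ) : ℂ) =
      ∫ t in (-(Real.pi / 2))..(Real.pi / 2),
        sumChar (fun i => 2 * μ.real {ω | Z i ω = 1} - 1) N t *
          Complex.exp (-((k * t : ℝ) * Complex.I)) := by
  have hT := measurable_partialSum hZ N
  have hm : MeasurableSet {ω | partialSum Z N ω = k} := hT (measurableSet_singleton k)
  have e : ∀ t : ℝ, sumChar (fun i => 2 * μ.real {ω | Z i ω = 1} - 1) N t *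
          Complex.exp (-((k * t : ℝ) * Complex.I)) =
      ∫ ω, Complex.exp ((t * (partialSum Z N ω - k : ℤ) : ℝ) * Complex.I) ∂μ := by
    intro t
    rw [← integral_cexp_partialSum hZ hind hsign, ← integral_mul_const]
    refine integral_congr_ae (Eventually.of_forall fun ω => ?_)
    simp only
    rw [← Complex.exp_add]
    congr 1
    push_cast
    ring
  simp only [e]
  rw [intervalIntegral_integral_swap]
  · have h : (fun ω => ∫ t in (-(Real.pi / 2))..(Real.pi / 2),
        Complex.exp ((t * (partialSum Z N ω - k : ℤ) : ℝ) * Complex.I)) =ᵐ[μ]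
        {ω | partialSum Z N ω = k}.indicator fun _ => (Real.pi : ℂ) := by
      filter_upwards [partialSum_mem_lattice hsign N] with ω hω
      rw [integral_cexp_lattice hk hω]
      simp [Set.indicator_apply]
    rw [integral_congr_ae h, integral_indicator_const _ hm, Complex.real_smul]
    push_cast
    ring
  · rw [Set.uIoc_of_le (by linarith [Real.pi_pos])]
    refine (integrable_const (1 : ℝ)).mono' (Measurable.aestronglyMeasurable ?_)
      (Eventually.of_forall fun x => ?_)
    · unfold Function.uncurry
      fun_prop
    · simp only [Function.uncurry]
      rw [Complex.norm_exp_ofReal_mul_I]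

/-- The Fourier transform of `exp (-s² / 2)`, expressed through the standard Gaussian density. -/
lemma integral_gaussian_mul_cexp (x : ℝ) :
    ∫ s : ℝ, Complex.exp (-(s : ℂ) ^ 2 / 2) * Complex.exp (-((x * s : ℝ) * Complex.I)) =
      ((Real.pi * (2 * gaussianPDFReal 0 1 x) : ℝ) : ℂ) := by
  have h := fourierIntegral_gaussian (b := 1 / 2) (by norm_num) (-x : ℂ)
  have e : ∀ s : ℝ, Complex.exp (-(s : ℂ) ^ 2 / 2) * Complex.exp (-((x * s : ℝ) * Complex.I)) =
      Complex.exp (Complex.I * (-x) * s) * Complex.exp (-(1 / 2) * s ^ 2) := by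
    intro s
    rw [← Complex.exp_add, ← Complex.exp_add]
    congr 1
    push_cast
    ring
  simp only [e]
  rw [h]
  have h1 : ((Real.pi : ℂ) / (1 / 2)) ^ (1 / 2 : ℂ) = ((√(2 * Real.pi) : ℝ) : ℂ) := by
    rw [Real.sqrt_eq_rpow, Complex.ofReal_cpow (by positivity)]
    push_cast
    ring_nf
  rw [h1, gaussianPDFReal]
  have h2 : Real.pi * (2 * ((√(2 * Real.pi * (1 : NNReal)))⁻¹ *
      Real.exp (-(x - 0) ^ 2 / (2 * (1 : NNReal))))) = √(2 * Real.pi) * Real.exp (-x ^ 2 / 2) := by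
    have h3 : √(2 * Real.pi) * √(2 * Real.pi) = 2 * Real.pi :=
      Real.mul_self_sqrt (by positivity)
    have h4 : 0 < √(2 * Real.pi) := by positivity
    simp only [NNReal.coe_one, mul_one, sub_zero]
    field_simp
    rw [mul_comm Real.pi 2, sq, h3]
  rw [h2]
  push_cast
  congr 2
  ring

/-- The local limit theorem in quantitative form, uniform in the lattice point `k`. -/
lemma abs_mul_measureReal_partialSum_sub_le (hZ : ∀ i, Measurable (Z i)) (hind : iIndepFun Z μ)
    (hsign : ∀ i, ∀ᵐ ω ∂μ, Z i ω = 1 ∨ Z i ω = -1) {N : ℕ} {k : ℤ} (hk : k ∈ lattice N)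
    {b : ℝ} (hb : 0 < b) :
    |b * μ.real {ω | partialSum Z N ω = k} - 2 * gaussianPDFReal 0 1 (k / b)| ≤
      charDefect (fun i => 2 * μ.real {ω | Z i ω = 1} - 1) N b / Real.pi := by
  have hpi := Real.pi_pos
  set m : ℕ → ℝ := fun i => 2 * μ.real {ω | Z i ω = 1} - 1 with hm
  set I : Set ℝ := Set.Ioc (-(Real.pi * b / 2)) (Real.pi * b / 2) with hI
  set F : ℝ → ℂ := I.indicator fun s => sumChar m N (s / b) with hF
  set e : ℝ → ℂ := fun s => Complex.exp (-((k / b * s : ℝ) * Complex.I)) with he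
  have hcs : Continuous fun s : ℝ => sumChar m N (s / b) :=
    (continuous_sumChar m N).comp (continuous_id.div_const _)
  have hce : Continuous e := by rw [he]; fun_prop
  have hne : ∀ s, ‖e s‖ = 1 := by
    intro s
    simp only [he]
    rw [← neg_mul, ← Complex.ofReal_neg, Complex.norm_exp_ofReal_mul_I]
  have h1 : ∫ s, F s * e s = ((Real.pi * (b * μ.real {ω | partialSum Z N ω = k}) : ℝ) : ℂ) := by
    have h2 : (fun s => F s * e s) = I.indicator fun s => sumChar m N (s / b) * e s := by
      ext s
      by_cases hs : s ∈ I <;> simp [hF, hs]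
    rw [h2, integral_indicator measurableSet_Ioc,
      ← intervalIntegral.integral_of_le (by nlinarith)]
    have h3 := intervalIntegral.integral_comp_div (a := -(Real.pi * b / 2)) (b := Real.pi * b / 2)
      (fun t => sumChar m N t * Complex.exp (-((k * t : ℝ) * Complex.I))) hb.ne'
    have h4 : -(Real.pi * b / 2) / b = -(Real.pi / 2) := by field_simp
    have h5 : Real.pi * b / 2 / b = Real.pi / 2 := by field_simp
    rw [h4, h5, ← pi_mul_measureReal_partialSum_eq hZ hind hsign hk] at h3
    have h6 : ∀ s, e s = Complex.exp (-((k * (s / b) : ℝ) * Complex.I)) := by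
      intro s
      simp only [he]
      congr 4
      ring
    simp only [h6]
    rw [h3, Complex.real_smul]
    push_cast
    ring
  have h2 := integral_gaussian_mul_cexp (k / b)
  have hiF : Integrable fun s => F s * e s := by
    have h3 : (fun s => F s * e s) = I.indicator fun s => sumChar m N (s / b) * e s := by
      ext s
      by_cases hs : s ∈ I <;> simp [hF, hs]
    rw [h3, integrable_indicator_iff measurableSet_Ioc]
    exact ((hcs.mul hce).integrableOn_Icc).mono_set Set.Ioc_subset_Icc_self
  have hiG : Integrable fun s : ℝ => Complex.exp (-(s : ℂ) ^ 2 / 2) * e s := by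
    refine (integrable_exp_neg_mul_sq (b := 1 / 2) (by norm_num)).mono'
      (Continuous.aestronglyMeasurable (Continuous.mul (by fun_prop) hce))
      (Eventually.of_forall fun s => ?_)
    rw [norm_mul, hne, mul_one, norm_cexp_neg_sq_div_two]
  have h3 : ((Real.pi * (b * μ.real {ω | partialSum Z N ω = k} -
      2 * gaussianPDFReal 0 1 (k / b)) : ℝ) : ℂ) =
      ∫ s, (F s - Complex.exp (-(s : ℂ) ^ 2 / 2)) * e s := by
    simp only [sub_mul]
    rw [integral_sub hiF hiG, h1, h2]
    push_cast
    ring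
  have h4 : Real.pi * |b * μ.real {ω | partialSum Z N ω = k} - 2 * gaussianPDFReal 0 1 (k / b)|
      ≤ charDefect m N b := by
    rw [show ∀ x : ℝ, Real.pi * |x| = ‖((Real.pi * x : ℝ) : ℂ)‖ from fun x => by
      rw [Complex.norm_real, Real.norm_eq_abs, abs_mul, abs_of_pos hpi], h3]
    refine (norm_integral_le_integral_norm _).trans (le_of_eq ?_)
    simp only [norm_mul, hne, mul_one]
    rfl
  rw [le_div_iff₀ hpi]
  linarith

end Sum

/-! ### The discrete Gaussian law -/

lemma ofReal_Phi_sub_Phi (x y : ℝ) :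
    ENNReal.ofReal (Phi y - Phi x) = gaussianReal 0 1 (Set.Ioc x y) := by
  conv_rhs => rw [← measure_cdf (gaussianReal 0 1)]
  rw [StieltjesFunction.measure_Ioc]
  rfl

lemma monotone_Phi : Monotone Phi := (cdf (gaussianReal 0 1)).mono

lemma Phi_neg (x : ℝ) : Phi (-x) = 1 - Phi x := by
  have h1 : Phi (-x) = (gaussianReal 0 1).real (Set.Ici x) := by
    rw [Phi, cdf_eq_real]
    have h := gaussianReal_map_neg (μ := 0) (v := 1)
    rw [neg_zero] at h
    conv_rhs => rw [← h]
    rw [map_measureReal_apply (by fun_prop) measurableSet_Ici]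
    congr 1
    ext y
    simp
  have := nullSingletonClass_gaussianReal (μ := 0) one_ne_zero
  have h2 : (gaussianReal 0 1).real (Set.Ici x) = (gaussianReal 0 1).real (Set.Ioi x) :=
    measureReal_congr Ioi_ae_eq_Ici.symm
  rw [h1, h2, Phi, cdf_eq_real, ← Set.compl_Iic, probReal_compl_eq_one_sub measurableSet_Iic]

lemma neg_mem_lattice_iff {N : ℕ} {k : ℤ} : -k ∈ lattice N ↔ k ∈ lattice N := by
  constructor
  · rintro ⟨m, hm⟩
    exact ⟨-m - ((N % 2 : ℕ) : ℤ), by omega⟩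
  · rintro ⟨m, hm⟩
    exact ⟨-m - ((N % 2 : ℕ) : ℤ), by omega⟩

lemma discreteGaussian_singleton (N : ℕ) (b : ℝ) (k : ℤ) :
    discreteGaussian N b {k} = ENNReal.ofReal ((lattice N).indicator
      (fun j : ℤ => Phi (((j : ℝ) + 1) / b) - Phi (((j : ℝ) - 1) / b)) k) := by
  rw [discreteGaussian, Measure.sum_smul_dirac_singleton]

/-- Rounding of `b * x` to the point `k` of `lattice N` with `k - 1 < b * x ≤ k + 1`. -/
noncomputable def latticeRound (N : ℕ) (b x : ℝ) : ℤ :=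
  2 * ⌈(b * x - 1 - ((N % 2 : ℕ) : ℝ)) / 2⌉ + ((N % 2 : ℕ) : ℤ)

lemma measurable_latticeRound (N : ℕ) (b : ℝ) : Measurable (latticeRound N b) := by
  unfold latticeRound
  have h : Measurable fun x : ℝ => ⌈(b * x - 1 - ((N % 2 : ℕ) : ℝ)) / 2⌉ :=
    Int.measurable_ceil.comp (by fun_prop)
  exact (h.const_mul 2).add_const _

lemma latticeRound_preimage {N : ℕ} {b : ℝ} (hb : 0 < b) {k : ℤ} (hk : k ∈ lattice N) :
    latticeRound N b ⁻¹' {k} = Set.Ioc (((k : ℝ) - 1) / b) (((k : ℝ) + 1) / b) := by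
  obtain ⟨m, rfl⟩ := hk
  ext x
  have h : latticeRound N b x = 2 * m + ((N % 2 : ℕ) : ℤ) ↔
      ⌈(b * x - 1 - ((N % 2 : ℕ) : ℝ)) / 2⌉ = m := by
    unfold latticeRound
    constructor <;> intro h <;> omega
  rw [Set.mem_preimage, Set.mem_singleton_iff, h, Int.ceil_eq_iff, Set.mem_Ioc, div_lt_iff₀ hb,
    le_div_iff₀ hb, Int.cast_add, Int.cast_mul, Int.cast_ofNat, Int.cast_natCast]
  constructor <;> rintro ⟨h1, h2⟩ <;> constructor <;> linarith

/-- The discrete Gaussian is the law of a standard Gaussian, scaled by `b` and rounded to the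
lattice. -/
lemma discreteGaussian_eq_map (N : ℕ) {b : ℝ} (hb : 0 < b) :
    discreteGaussian N b = (gaussianReal 0 1).map (latticeRound N b) := by
  refine Measure.ext_of_singleton fun k => ?_
  rw [discreteGaussian_singleton, Measure.map_apply (measurable_latticeRound N b)
    (measurableSet_singleton k)]
  by_cases hk : k ∈ lattice N
  · rw [Set.indicator_of_mem hk, ofReal_Phi_sub_Phi, latticeRound_preimage hb hk]
  · have h : latticeRound N b ⁻¹' {k} = ∅ := by
      ext x
      simp only [Set.mem_preimage, Set.mem_singleton_iff, Set.mem_empty_iff_false, iff_false]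
      rintro rfl
      exact hk ⟨_, rfl⟩
    rw [Set.indicator_of_notMem hk, h, ENNReal.ofReal_zero, measure_empty]

lemma isProbabilityMeasure_discreteGaussian (N : ℕ) {b : ℝ} (hb : 0 < b) :
    IsProbabilityMeasure (discreteGaussian N b) := by
  rw [discreteGaussian_eq_map N hb]
  exact Measure.isProbabilityMeasure_map (measurable_latticeRound N b).aemeasurable

lemma discreteGaussian_map_neg (N : ℕ) (b : ℝ) :
    (discreteGaussian N b).map (fun k : ℤ => -k) = discreteGaussian N b := by
  refine Measure.ext_of_singleton fun k => ?_
  have hpre : (fun k : ℤ => -k) ⁻¹' {k} = {-k} := by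
    ext j
    simp
  rw [Measure.map_apply (by fun_prop) (measurableSet_singleton k), hpre,
    discreteGaussian_singleton, discreteGaussian_singleton]
  congr 1
  by_cases hk : k ∈ lattice N
  · rw [Set.indicator_of_mem hk, Set.indicator_of_mem (neg_mem_lattice_iff.2 hk)]
    have h1 : (((-k : ℤ) : ℝ) + 1) / b = -(((k : ℝ) - 1) / b) := by push_cast; ring
    have h2 : (((-k : ℤ) : ℝ) - 1) / b = -(((k : ℝ) + 1) / b) := by push_cast; ring
    rw [h1, h2, Phi_neg, Phi_neg]
    ring
  · rw [Set.indicator_of_notMem hk, Set.indicator_of_notMem (mt neg_mem_lattice_iff.1 hk)]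

lemma Phi_sub_Phi_eq_integral {x y : ℝ} (hxy : x ≤ y) :
    Phi y - Phi x = ∫ t in x..y, gaussianPDFReal 0 1 t := by
  have h := ofReal_Phi_sub_Phi x y
  rw [gaussianReal_apply_eq_integral _ one_ne_zero] at h
  rw [intervalIntegral.integral_of_le hxy]
  exact (ENNReal.ofReal_eq_ofReal_iff (sub_nonneg.2 (monotone_Phi hxy))
    (integral_nonneg fun t => gaussianPDFReal_nonneg _ _ t)).1 h

lemma gaussianPDFReal_zero_one (x : ℝ) :
    gaussianPDFReal 0 1 x = (√(2 * Real.pi))⁻¹ * Real.exp (-x ^ 2 / 2) := by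
  simp [gaussianPDFReal]

lemma abs_gaussianPDFReal_sub_le (x y : ℝ) :
    |gaussianPDFReal 0 1 y - gaussianPDFReal 0 1 x| ≤ |y - x| := by
  have hd : ∀ t : ℝ, HasDerivAt (gaussianPDFReal 0 1)
      ((√(2 * Real.pi))⁻¹ * (Real.exp (-t ^ 2 / 2) * (-t))) t := by
    intro t
    have h1 : HasDerivAt (fun t : ℝ => -t ^ 2 / 2) (-t) t := by
      have := ((hasDerivAt_pow 2 t).neg).div_const 2
      refine this.congr_deriv ?_
      simp [neg_div]
    have h2 := (h1.exp).const_mul (√(2 * Real.pi))⁻¹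
    exact h2.congr_of_eventuallyEq (Eventually.of_forall gaussianPDFReal_zero_one)
  have hb : ∀ t ∈ Set.univ, ‖(√(2 * Real.pi))⁻¹ * (Real.exp (-t ^ 2 / 2) * (-t))‖ ≤ (1 : ℝ) := by
    intro t _
    have hs : (√(2 * Real.pi))⁻¹ ≤ 1 := by
      refine inv_le_one_of_one_le₀ (Real.one_le_sqrt.2 ?_)
      linarith [Real.pi_gt_three]
    have he : Real.exp (-t ^ 2 / 2) * |t| ≤ 1 := by
      have h1 : t ^ 2 / 2 + 1 ≤ Real.exp (t ^ 2 / 2) := Real.add_one_le_exp _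
      have h2 : |t| ≤ Real.exp (t ^ 2 / 2) := by
        nlinarith [sq_nonneg (|t| - 1), sq_abs t]
      rw [neg_div, Real.exp_neg, ← div_eq_inv_mul]
      exact (div_le_one (Real.exp_pos _)).2 h2
    rw [norm_mul, norm_mul, norm_neg, Real.norm_eq_abs, Real.norm_eq_abs, Real.norm_eq_abs,
      abs_of_nonneg (by positivity), abs_of_pos (Real.exp_pos _)]
    exact mul_le_one₀ hs (by positivity) he
  have h := convex_univ.norm_image_sub_le_of_norm_hasDerivWithin_le
    (fun t _ => (hd t).hasDerivWithinAt) hb (Set.mem_univ x) (Set.mem_univ y)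
  simpa using h

/-- The mass of the discrete Gaussian at `k` is the Gaussian density at `k / b` times the mesh
size `2 / b`, up to an error uniform in `k`. -/
lemma abs_mul_Phi_sub_Phi_sub_le {b : ℝ} (hb : 0 < b) (x : ℝ) :
    |b * (Phi ((x + 1) / b) - Phi ((x - 1) / b)) - 2 * gaussianPDFReal 0 1 (x / b)| ≤ 2 / b := by
  have hle : (x - 1) / b ≤ (x + 1) / b := by gcongr; linarith
  rw [Phi_sub_Phi_eq_integral hle]
  have hlen : (x + 1) / b - (x - 1) / b = 2 / b := by field_simp; ring
  have hint : IntervalIntegrable (gaussianPDFReal 0 1) volume ((x - 1) / b) ((x + 1) / b) :=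
    (integrable_gaussianPDFReal 0 1).intervalIntegrable
  have h1 : b * (∫ t in ((x - 1) / b)..((x + 1) / b), gaussianPDFReal 0 1 t)
      - 2 * gaussianPDFReal 0 1 (x / b) =
      b * ∫ t in ((x - 1) / b)..((x + 1) / b),
        (gaussianPDFReal 0 1 t - gaussianPDFReal 0 1 (x / b)) := by
    rw [intervalIntegral.integral_sub hint intervalIntegrable_const,
      intervalIntegral.integral_const, hlen, smul_eq_mul]
    field_simp
  have h2 : ‖∫ t in ((x - 1) / b)..((x + 1) / b),
      (gaussianPDFReal 0 1 t - gaussianPDFReal 0 1 (x / b))‖ ≤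
      1 / b * |(x + 1) / b - (x - 1) / b| := by
    refine intervalIntegral.norm_integral_le_of_norm_le_const fun t ht => ?_
    rw [Set.uIoc_of_le hle] at ht
    refine (abs_gaussianPDFReal_sub_le _ _).trans (abs_le.2 ⟨?_, ?_⟩)
    · have := ht.1
      have e : (x - 1) / b = x / b - 1 / b := by ring
      linarith
    · have := ht.2
      have e : (x + 1) / b = x / b + 1 / b := by ring
      linarith
  rw [h1, abs_mul, abs_of_pos hb]
  rw [hlen, abs_of_pos (by positivity : 0 < 2 / b)] at h2
  calc b * |∫ t in ((x - 1) / b)..((x + 1) / b),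
        (gaussianPDFReal 0 1 t - gaussianPDFReal 0 1 (x / b))|
      ≤ b * (1 / b * (2 / b)) := by gcongr; exact h2
    _ = 2 / b := by field_simp

/-! ### Total variation on the integers and tail bounds -/

lemma bddAbove_measureReal_sub {Ω : Type*} [MeasurableSpace Ω] (P Q : Measure Ω)
    [IsProbabilityMeasure P] :
    BddAbove (Set.range fun A : {A : Set Ω // MeasurableSet A} => P.real A.1 - Q.real A.1) := by
  refine ⟨1, ?_⟩
  rintro _ ⟨A, rfl⟩
  have h1 : P.real A.1 ≤ 1 := measureReal_le_one
  have h2 : 0 ≤ Q.real A.1 := measureReal_nonneg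
  simp only
  linarith

lemma tvDist_nonneg {Ω : Type*} [MeasurableSpace Ω] (P Q : Measure Ω) [IsProbabilityMeasure P] :
    0 ≤ tvDist P Q := by
  have h := le_ciSup (bddAbove_measureReal_sub P Q) ⟨∅, MeasurableSet.empty⟩
  simpa [tvDist] using h

/-- Scheffé-type estimate: since the total variation distance is one-sided, only the tail of `P` has
to be controlled outside a finite window. -/
lemma tvDist_le_of_singleton_le {P Q : Measure ℤ} [IsProbabilityMeasure P] [IsProbabilityMeasure Q]
    {η : ℝ} (h : ∀ k, P.real {k} - Q.real {k} ≤ η) (hη : 0 ≤ η) (K : ℕ) :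
    tvDist P Q ≤ (2 * K + 1) * η + P.real {k | (K : ℤ) < |k|} := by
  have : Nonempty {A : Set ℤ // MeasurableSet A} := ⟨⟨∅, MeasurableSet.empty⟩⟩
  refine ciSup_le fun ⟨A, hA⟩ => ?_
  classical
  set F : Finset ℤ := (Finset.Icc (-(K : ℤ)) K).filter (· ∈ A) with hF
  have hcard : (F.card : ℝ) ≤ 2 * K + 1 := by
    have h1 : F.card ≤ (Finset.Icc (-(K : ℤ)) K).card := Finset.card_filter_le _ _
    rw [Int.card_Icc] at h1
    have h2 : F.card ≤ 2 * K + 1 := by omega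
    exact_mod_cast h2
  have hFA : (F : Set ℤ) ⊆ A := fun k hk => (Finset.mem_filter.1 (Finset.mem_coe.1 hk)).2
  have hP : P.real A ≤ P.real (F : Set ℤ) + P.real {k | (K : ℤ) < |k|} := by
    refine (measureReal_mono ?_).trans (measureReal_union_le _ _)
    intro k hk
    by_cases hk' : (K : ℤ) < |k|
    · exact Or.inr hk'
    · refine Or.inl (Finset.mem_coe.2 (Finset.mem_filter.2 ⟨Finset.mem_Icc.2 ?_, hk⟩))
      exact abs_le.1 (not_lt.1 hk')
  have hQ : Q.real (F : Set ℤ) ≤ Q.real A := measureReal_mono hFA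
  have hsum : P.real (F : Set ℤ) - Q.real (F : Set ℤ) ≤ (2 * K + 1) * η := by
    rw [← sum_measureReal_singleton, ← sum_measureReal_singleton, ← Finset.sum_sub_distrib]
    refine (Finset.sum_le_sum fun k _ => h k).trans ?_
    rw [Finset.sum_const, nsmul_eq_mul]
    exact mul_le_mul_of_nonneg_right hcard hη
  simp only
  linarith

section

variable {Ω : Type*} [MeasurableSpace Ω] {μ : Measure Ω} [IsProbabilityMeasure μ]
  {Z : ℕ → Ω → ℤ}

/-- Point masses of `T_N` exceed those of the discrete Gaussian by `o(1 / b)`, uniformly in `k`. Off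
the lattice the point masses of `T_N` vanish. -/
lemma map_partialSum_singleton_sub_le (hZ : ∀ i, Measurable (Z i)) (hind : iIndepFun Z μ)
    (hsign : ∀ i, ∀ᵐ ω ∂μ, Z i ω = 1 ∨ Z i ω = -1) {N : ℕ} {b : ℝ} (hb : 0 < b)
    (k : ℤ) :
    (μ.map (partialSum Z N)).real {k} - (discreteGaussian N b).real {k} ≤
      (charDefect (fun i => 2 * μ.real {ω | Z i ω = 1} - 1) N b / Real.pi + 2 / b) / b := by
  have hpi := Real.pi_pos
  have hδ : 0 ≤ charDefect (fun i => 2 * μ.real {ω | Z i ω = 1} - 1) N b :=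
    integral_nonneg fun _ => norm_nonneg _
  have hp : (μ.map (partialSum Z N)).real {k} = μ.real {ω | partialSum Z N ω = k} :=
    map_measureReal_apply (measurable_partialSum hZ N) (measurableSet_singleton k)
  rw [hp]
  by_cases hk : k ∈ lattice N
  · have h1 := abs_le.1 (abs_mul_measureReal_partialSum_sub_le hZ hind hsign hk hb)
    have h2 := abs_le.1 (abs_mul_Phi_sub_Phi_sub_le hb k)
    have hmono : Phi (((k : ℝ) - 1) / b) ≤ Phi (((k : ℝ) + 1) / b) :=
      monotone_Phi (by gcongr; linarith)
    rw [measureReal_def (discreteGaussian N b), discreteGaussian_singleton,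
      Set.indicator_of_mem hk, ENNReal.toReal_ofReal (sub_nonneg.2 hmono), le_div_iff₀ hb]
    linarith [h1.2, h2.1]
  · have h0 : μ.real {ω | partialSum Z N ω = k} = 0 := by
      rw [measureReal_def, measure_eq_zero_iff_ae_notMem.2, ENNReal.toReal_zero]
      filter_upwards [partialSum_mem_lattice hsign N] with ω hω h
      exact hk (h ▸ hω)
    have hq : 0 ≤ (discreteGaussian N b).real {k} := measureReal_nonneg
    have : 0 ≤ (charDefect (fun i => 2 * μ.real {ω | Z i ω = 1} - 1) N b / Real.pi + 2 / b) / b := by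
      positivity
    linarith

/-- Chebyshev's inequality for `T_N`, when its mean is at most its standard deviation `b`. -/
lemma measureReal_partialSum_tail_le (hZ : ∀ i, Measurable (Z i))
    (hsign : ∀ i, ∀ᵐ ω ∂μ, Z i ω = 1 ∨ Z i ω = -1) {N : ℕ} {b : ℝ} (hb : 0 < b)
    (hvar : variance (fun ω => (partialSum Z N ω : ℝ)) μ = b ^ 2)
    (hmean : |∫ ω, (partialSum Z N ω : ℝ) ∂μ| ≤ b) {M : ℝ} (hM : 1 < M) :
    (μ.map (partialSum Z N)).real {k | ((⌊M * b⌋₊ : ℕ) : ℤ) < |k|} ≤ 1 / (M - 1) ^ 2 := by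
  have hc : 0 < (M - 1) * b := mul_pos (by linarith) hb
  rw [map_measureReal_apply (measurable_partialSum hZ N) (MeasurableSet.of_discrete)]
  have h := meas_ge_le_variance_div_sq (memLp_two_partialSum hZ hsign N) hc
  rw [hvar] at h
  have h2 : b ^ 2 / ((M - 1) * b) ^ 2 = 1 / (M - 1) ^ 2 := by
    have : M - 1 ≠ 0 := by linarith
    field_simp
  rw [h2] at h
  refine ENNReal.toReal_le_of_le_ofReal (by positivity) ((measure_mono ?_).trans h)
  intro ω hω
  simp only [Set.mem_preimage, Set.mem_ofPred_eq] at hω ⊢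
  have h3 : M * b < |(partialSum Z N ω : ℝ)| := by
    have h4 : ((⌊M * b⌋₊ : ℕ) : ℤ) + 1 ≤ |partialSum Z N ω| := hω
    have h5 : ((⌊M * b⌋₊ : ℕ) : ℝ) + 1 ≤ |(partialSum Z N ω : ℝ)| := by exact_mod_cast h4
    exact (Nat.lt_floor_add_one _).trans_le h5
  have h6 := abs_sub_abs_le_abs_sub (partialSum Z N ω : ℝ) (∫ ω, (partialSum Z N ω : ℝ) ∂μ)
  linarith

end

/-! ### Growth of the variance and conclusion -/

/-- Growth consequences of `liminf b_N² / N > 0`. -/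
lemma growth_of_liminf_pos {a b : ℕ → ℝ} (hb : ∀ N, 0 ≤ b N)
    (hmean : Tendsto (fun N : ℕ => a N / √(N : ℝ)) atTop (𝓝 0))
    (hvar : 0 < liminf (fun N : ℕ => b N ^ 2 / (N : ℝ)) atTop) :
    Tendsto b atTop atTop ∧ Tendsto (fun N => a N / b N) atTop (𝓝 0) ∧
      Tendsto (fun N : ℕ => (N : ℝ) / b N ^ 3) atTop (𝓝 0) := by
  obtain ⟨c, hc0, hc⟩ := exists_between hvar
  have hbdd : IsBoundedUnder (· ≥ ·) atTop (fun N : ℕ => b N ^ 2 / (N : ℝ)) :=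
    isBoundedUnder_of ⟨0, fun N => by positivity⟩
  have hev : ∀ᶠ N : ℕ in atTop, √c * √(N : ℝ) ≤ b N ∧ 0 < b N ∧ c * N ≤ b N ^ 2 ∧ 0 < N := by
    filter_upwards [eventually_lt_of_lt_liminf hc hbdd, eventually_gt_atTop 0] with N hN hN0
    have hNR : (0 : ℝ) < N := by exact_mod_cast hN0
    have h1 : c * N ≤ b N ^ 2 := ((lt_div_iff₀ hNR).1 hN).le
    have h2 : √c * √(N : ℝ) ≤ b N := by
      rw [← Real.sqrt_mul hc0.le]
      exact (Real.sqrt_le_left (hb N)).2 h1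
    have h3 : 0 < √c * √(N : ℝ) := by positivity
    exact ⟨h2, h3.trans_le h2, h1, hN0⟩
  have hsqrt : Tendsto (fun N : ℕ => √(N : ℝ)) atTop atTop :=
    Real.tendsto_sqrt_atTop.comp tendsto_natCast_atTop_atTop
  have htop : Tendsto b atTop atTop :=
    tendsto_atTop_mono' _ (hev.mono fun N h => h.1) (hsqrt.const_mul_atTop (Real.sqrt_pos.2 hc0))
  refine ⟨htop, ?_, ?_⟩
  · have hlim : Tendsto (fun N : ℕ => |a N / √(N : ℝ)| / √c) atTop (𝓝 0) := by
      simpa using hmean.abs.div_const (√c)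
    refine squeeze_zero_norm' ?_ hlim
    filter_upwards [hev] with N hN
    obtain ⟨h1, h2, -, h4⟩ := hN
    have hNR : (0 : ℝ) < √(N : ℝ) := Real.sqrt_pos.2 (by exact_mod_cast h4)
    have hcp : 0 < √c := Real.sqrt_pos.2 hc0
    rw [Real.norm_eq_abs, abs_div, abs_div, abs_of_pos h2, abs_of_pos hNR, div_div,
      mul_comm (√(N : ℝ))]
    gcongr
  · have hlim : Tendsto (fun N : ℕ => (b N)⁻¹ / c) atTop (𝓝 0) := by
      simpa using (tendsto_inv_atTop_zero.comp htop).div_const c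
    refine squeeze_zero_norm' ?_ hlim
    filter_upwards [hev] with N hN
    obtain ⟨-, h2, h3, -⟩ := hN
    rw [Real.norm_eq_abs, abs_of_nonneg (by positivity), div_le_div_iff₀ (by positivity) hc0]
    have h4 : (b N)⁻¹ * b N ^ 3 = b N ^ 2 := by field_simp
    rw [h4]
    linarith

end SignCLT

theorem lemma2 {Ω : Type*} [MeasurableSpace Ω] (μ : Measure Ω) [IsProbabilityMeasure μ]
    (Z : ℕ → Ω → ℤ) (hZmeas : ∀ i, Measurable (Z i)) (hZindep : iIndepFun Z μ)
    (hZsign : ∀ i, ∀ᵐ ω ∂μ, Z i ω = 1 ∨ Z i ω = -1)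
    (r : ℕ → ℝ) (hr : ∀ i, r i = μ.real {ω | Z i ω = 1})
    (a b : ℕ → ℝ)
    (ha : ∀ N, a N = ∫ ω, (SignCLT.partialSum Z N ω : ℝ) ∂μ)
    (hb : ∀ N, b N = √(variance (fun ω => (SignCLT.partialSum Z N ω : ℝ)) μ))
    (hmean : Tendsto (fun N : ℕ => a N / √(N : ℝ)) atTop (𝓝 0))
    (hvar : 0 < liminf (fun N : ℕ => b N ^ 2 / (N : ℝ)) atTop) :
    (∀ N, a N = ∑ i ∈ Finset.range N, (2 * r i - 1)) ∧
    (∀ N, b N ^ 2 = 4 * ∑ i ∈ Finset.range N, r i * (1 - r i)) ∧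
    (∀ N, 0 < b N →
      IsProbabilityMeasure (SignCLT.discreteGaussian N (b N)) ∧
      (SignCLT.discreteGaussian N (b N)).map (fun k : ℤ => -k) =
        SignCLT.discreteGaussian N (b N)) ∧
    Tendsto
      (fun N : ℕ => SignCLT.tvDist (μ.map (SignCLT.partialSum Z N))
        (SignCLT.discreteGaussian N (b N)))
      atTop (𝓝 0) := by
  obtain rfl : r = fun i => μ.real {ω | Z i ω = 1} := funext hr
  have hsum : ∀ N, a N = ∑ i ∈ Finset.range N, (2 * μ.real {ω | Z i ω = 1} - 1) := fun N => by
    rw [ha, SignCLT.integral_partialSum hZmeas hZsign]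
  have hb0 : ∀ N, 0 ≤ b N := fun N => by rw [hb]; exact Real.sqrt_nonneg _
  have hbv : ∀ N, variance (fun ω => (SignCLT.partialSum Z N ω : ℝ)) μ = b N ^ 2 := fun N => by
    rw [hb, Real.sq_sqrt (variance_nonneg _ _)]
  have hbm : ∀ N, b N ^ 2 =
      ∑ i ∈ Finset.range N, (1 - (2 * μ.real {ω | Z i ω = 1} - 1) ^ 2) := fun N => by
    rw [← hbv, SignCLT.variance_partialSum hZmeas hZindep hZsign]
  refine ⟨hsum, fun N => ?_, fun N hN => ⟨SignCLT.isProbabilityMeasure_discreteGaussian N hN,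
    SignCLT.discreteGaussian_map_neg N (b N)⟩, ?_⟩
  · rw [hbm, Finset.mul_sum]
    exact Finset.sum_congr rfl fun i _ => by ring
  set m : ℕ → ℝ := fun i => 2 * μ.real {ω | Z i ω = 1} - 1 with hm
  have hm1 : ∀ i, |m i| ≤ 1 := fun i => by
    have h0 : 0 ≤ μ.real {ω | Z i ω = 1} := measureReal_nonneg
    have h1 : μ.real {ω | Z i ω = 1} ≤ 1 := measureReal_le_one
    exact abs_le.2 ⟨by simp only [hm]; linarith, by simp only [hm]; linarith⟩
  obtain ⟨hbtop, hab, hcub⟩ := SignCLT.growth_of_liminf_pos hb0 hmean hvar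
  have hab' : Tendsto (fun N => (∑ i ∈ Finset.range N, m i) / b N) atTop (𝓝 0) :=
    hab.congr fun N => by rw [hsum]
  have hδ := SignCLT.tendsto_charDefect hm1 hbm hbtop hab' hcub
  have hprob : ∀ N, IsProbabilityMeasure (μ.map (SignCLT.partialSum Z N)) := fun N =>
    Measure.isProbabilityMeasure_map (SignCLT.measurable_partialSum hZmeas N).aemeasurable
  have hbinv : Tendsto (fun N => (b N)⁻¹) atTop (𝓝 0) := tendsto_inv_atTop_zero.comp hbtop
  -- for a fixed window `[-M b_N, M b_N]` the local limit theorem makes the first term vanish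
  have hlocal : ∀ M : ℝ, Tendsto (fun N => (2 * M + (b N)⁻¹) *
      (SignCLT.charDefect m N (b N) / Real.pi + 2 * (b N)⁻¹)) atTop (𝓝 0) := fun M => by
    have h := (hbinv.const_add (2 * M)).mul ((hδ.div_const Real.pi).add (hbinv.const_mul 2))
    simpa using h
  have hbound : ∀ M : ℝ, 1 < M → ∀ᶠ N in atTop,
      SignCLT.tvDist (μ.map (SignCLT.partialSum Z N)) (SignCLT.discreteGaussian N (b N)) ≤
        (2 * M + (b N)⁻¹) * (SignCLT.charDefect m N (b N) / Real.pi + 2 * (b N)⁻¹) +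
          1 / (M - 1) ^ 2 := by
    intro M hM
    filter_upwards [hbtop.eventually_gt_atTop 0,
      hab.eventually (Metric.ball_mem_nhds (0 : ℝ) one_pos)] with N hN haN
    have := SignCLT.isProbabilityMeasure_discreteGaussian N hN
    have hδ0 : 0 ≤ SignCLT.charDefect m N (b N) := integral_nonneg fun _ => norm_nonneg _
    have hpi := Real.pi_pos
    have haN' : |∫ ω, (SignCLT.partialSum Z N ω : ℝ) ∂μ| ≤ b N := by
      rw [← ha]
      have h := mem_ball_zero_iff.1 haN
      rw [Real.norm_eq_abs, abs_div, abs_of_pos hN, div_lt_one hN] at h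
      exact h.le
    refine (SignCLT.tvDist_le_of_singleton_le
      (SignCLT.map_partialSum_singleton_sub_le hZmeas hZindep hZsign hN) (by positivity)
      ⌊M * b N⌋₊).trans (add_le_add ?_
        (SignCLT.measureReal_partialSum_tail_le hZmeas hZsign hN (hbv N) haN' hM))
    have hfl : (⌊M * b N⌋₊ : ℝ) ≤ M * b N := Nat.floor_le (by positivity)
    calc (2 * (⌊M * b N⌋₊ : ℝ) + 1) * ((SignCLT.charDefect m N (b N) / Real.pi + 2 / b N) / b N)
        ≤ (2 * (M * b N) + 1) * ((SignCLT.charDefect m N (b N) / Real.pi + 2 / b N) / b N) := by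
          gcongr
      _ = _ := by field_simp
  refine Metric.tendsto_atTop'.2 fun ε hε => ?_
  -- a window so wide that the Chebyshev term `1 / (M - 1)²` is at most `ε / 2`
  obtain ⟨M, hM1, hM⟩ : ∃ M : ℝ, 1 < M ∧ 1 / (M - 1) ^ 2 ≤ ε / 2 := by
    refine ⟨1 + √(2 / ε), by simpa using hε, le_of_eq ?_⟩
    rw [add_sub_cancel_left, Real.sq_sqrt (by positivity)]
    field_simp
  have hev := (hbound M hM1).and ((hlocal M).eventually_lt_const (half_pos hε))
  obtain ⟨N₀, hN₀⟩ := eventually_atTop.1 hev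
  refine ⟨N₀, fun N hN => ?_⟩
  obtain ⟨h1, h2⟩ := hN₀ N hN.le
  have h3 := SignCLT.tvDist_nonneg (μ.map (SignCLT.partialSum Z N))
    (SignCLT.discreteGaussian N (b N))
  rw [Real.dist_eq, sub_zero, abs_of_nonneg h3]
  linarith
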